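/- Let $N$ be a positive and $m$ a nonnegative integer, let $f_1,\dots,f_N:\mathbb{R}^m\to\mathbb{R}^m$, and let $K\ge 0$ be a constant. Write $|\cdot|$ and $\langle\cdot,\cdot\rangle$ for the Euclidean norm and inner product. Assume: (A1) For each $i$ there is a $C^1$ convex function $F_i:\mathbb{R}^m\to\mathbb{R}$ with $\arg\min F_i\neq\emptyset$ such that $f_i=-\nabla F_i$. (A2) For each $i$ the set $\{z: f_i(z)=0\}$ is nonempty and bounded, and $\langle z-P_{\Theta_*}(z), f_i(z)\rangle\le 0$ for all $z\in\mathbb{R}^m$ and all $i=1,\dots,N$, where $\Theta_*$ is the convex hull of $\bigcup_{i=1}^N\{z:f_i(z)=0\}$ and $P_{\Theta_*}$ is the Euclidean projection onto $\Theta_*$. Let $\mathrm{G}$ be a fixed, undirected, connected graph on the nodes $1,\dots,N$, let $\mathcal{N}_i$ be the set of neighbors of node $i$, and let $a_{ij}=a_{ji}>0$ be a constant weight for each edge $\{i,j\}$. Consider the system $$\dot x_i(t)=f_i(x_i(t))+K\sum_{j\in\mathcal{N}_i}a_{ij}\,(x_j(t)-x_i(t)),\qquad i=1,\dots,N. \qquad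 (\mathrm{syn})$$ A solution on $[0,\infty)$ is understood in the Carathéodory sense: each $x_i$ is absolutely continuous on every $[0,T]$, and the equations hold for almost every $t>0$. The system achieves global synchronization if, for every initial value $x^0\in\mathbb{R}^{mN}$, a solution on $[0,\infty)$ with $x(0)=x^0$ exists and every such solution satisfies $\lim_{t\to\infty}|x_i(t)-x_j(t)|=0$ for all $i,j$. Then for every $x^0\in\mathbb{R}^{mN}$ a solution of (syn) on $[0,\infty)$ with $x(0)=x^0$ exists. If (syn) achieves global synchronization, then $\bigcap_{i=1}^N\{z:f_i(z)=0\}\neq\emptyset$. If $K>0$, the converse also holds, so that (syn) achieves global synchronization if and only if $\bigcap_{i=1}^N\{z:f_i(z)=0\}\neq\emptyset$. -/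

import Mathlib

open Set Filter Topology MeasureTheory

noncomputable section

namespace NetSync

/-- The node state space `ℝ^m` with the Euclidean norm. -/
abbrev State (m : ℕ) : Type := EuclideanSpace ℝ (Fin m)

/-- The zero set `{z : g z = 0}` of a vector field `g`. -/
def zeroSet {m : ℕ} (g : State m → State m) : Set (State m) := {z | g z = 0}

/-- The projector onto `S`: a point of `S` at distance `inf_{y ∈ S} |x - y|` from `x`.
For nonempty closed convex `S` such a point exists and is unique, see `projector_spec` and
`eq_projector`. -/
def projector {m : ℕ} (S : Set (State m)) (x : State m) : State m :=
  Classical.epsilon fun p => p ∈ S ∧ dist x p = Metric.infDist x S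

theorem projector_spec {m : ℕ} {S : Set (State m)} (hne : S.Nonempty) (hc : IsClosed S)
    (x : State m) : projector S x ∈ S ∧ dist x (projector S x) = Metric.infDist x S := by
  obtain ⟨p, hp, hd⟩ := hc.exists_infDist_eq_dist hne x
  exact Classical.epsilon_spec (p := fun p => p ∈ S ∧ dist x p = Metric.infDist x S)
    ⟨p, hp, hd.symm⟩

theorem eq_projector {m : ℕ} {S : Set (State m)} (hc : IsClosed S) (hconv : Convex ℝ S)
    {x p : State m} (hp : p ∈ S) (hd : dist x p = Metric.infDist x S) :
    p = projector S x := by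
  obtain ⟨hq, hdq⟩ := projector_spec ⟨p, hp⟩ hc x
  by_contra hne
  have hmem : midpoint ℝ p (projector S x) ∈ S := hconv.midpoint_mem hp hq
  have h1 : Metric.infDist x S ≤ dist x (midpoint ℝ p (projector S x)) :=
    Metric.infDist_le_dist_of_mem hmem
  have h2 : ‖(1 / 2 : ℝ) • ((x - p) + (x - projector S x))‖ < ‖x - p‖ := by
    refine (norm_midpoint_lt_iff ?_).2 fun h => hne (sub_right_injective h)
    rw [← dist_eq_norm, ← dist_eq_norm, hd, hdq]
  have h3 : x - midpoint ℝ p (projector S x) =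
      (1 / 2 : ℝ) • ((x - p) + (x - projector S x)) := by
    rw [midpoint_eq_smul_add, invOf_eq_inv]
    module
  rw [← h3, ← dist_eq_norm, ← dist_eq_norm, hd] at h2
  exact absurd h1 (not_le.2 h2)

/-- `Θ_*`, the convex hull of the union of the zero sets of the `f i`. -/
def zeroHull {N m : ℕ} (f : Fin N → State m → State m) : Set (State m) :=
  convexHull ℝ (⋃ i, zeroSet (f i))

/-- First assumption: each `f i` is the negative gradient of a `C¹` convex function on `ℝ^m`
that has a minimizer. -/
def AssumptionA1 {N m : ℕ} (f : Fin N → State m → State m) : Prop :=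
  ∃ F : Fin N → State m → ℝ, ∀ i,
    ContDiff ℝ 1 (F i) ∧ ConvexOn ℝ univ (F i) ∧ (∃ z, ∀ y, F i z ≤ F i y) ∧
      ∀ z, f i z = -gradient (F i) z

/-- Second assumption: every zero set is nonempty and bounded, and
`⟪z - P_{Θ_*} z, f i z⟫ ≤ 0` for all `z` and `i`. -/
def AssumptionA2 {N m : ℕ} (f : Fin N → State m → State m) : Prop :=
  (∀ i, (zeroSet (f i)).Nonempty ∧ Bornology.IsBounded (zeroSet (f i))) ∧
    ∀ i z, inner ℝ (z - projector (zeroHull f) z) (f i z) ≤ 0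

open Classical in
/-- The right-hand side of node `i`:
`f i (y i) + K * ∑_{j neighbor of i} a i j (y j - y i)`. -/
def rhs {N m : ℕ} (f : Fin N → State m → State m) (G : SimpleGraph (Fin N))
    (a : Fin N → Fin N → ℝ) (K : ℝ) (y : Fin N → State m) (i : Fin N) : State m :=
  f i (y i) + K • ∑ j ∈ G.neighborFinset i, a i j • (y j - y i)

/-- `x` is a Carathéodory solution on `[0, ∞)` with initial value `x₀`: it is absolutely
continuous on every `[0, T]` and satisfies the differential equation at almost every `t > 0`. -/
structure IsCaratheodorySolution {N m : ℕ} (f : Fin N → State m → State m)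
    (G : SimpleGraph (Fin N)) (a : Fin N → Fin N → ℝ) (K : ℝ)
    (x₀ : Fin N → State m) (x : ℝ → Fin N → State m) : Prop where
  initial : x 0 = x₀
  absCont : ∀ i, ∀ T, 0 ≤ T → AbsolutelyContinuousOnInterval (fun t => x t i) 0 T
  ode : ∀ᵐ t : ℝ, 0 < t → ∀ i, HasDerivAt (fun s => x s i) (rhs f G a K (x t) i) t

/-- Global synchronization: from every initial value the solution exists on `[0, ∞)`, and
along every solution all differences `|x_i(t) - x_j(t)|` tend to `0`. -/
def GlobalSync {N m : ℕ} (f : Fin N → State m → State m) (G : SimpleGraph (Fin N))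
    (a : Fin N → Fin N → ℝ) (K : ℝ) : Prop :=
  ∀ x₀ : Fin N → State m,
    (∃ x, IsCaratheodorySolution f G a K x₀ x) ∧
      ∀ x, IsCaratheodorySolution f G a K x₀ x →
        ∀ i j, Tendsto (fun t => ‖x t i - x t j‖) atTop (𝓝 0)

end NetSync

end

/-!
The network vector field is the negative gradient, on `(ℝ^m)^N`, of the `C¹` convex potential
`∑ i, F i (y i) + (K / 4) * ∑ i, ∑ j, w i j * ‖y i - y j‖ ^ 2`. In particular it is continuous and
dissipative: `⟪A x - A y, x - y⟫ ≤ 0`.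

*Existence.* A continuous field need not be Lipschitz, but a dissipative one admits global solutions
(`exists_solution_of_dissipative`): replace it by smooth fields up to a small uniform error on a
large ball, solve those by Picard–Lindelöf, and use that two `ε`-approximate solutions with the same
initial value separate at most linearly in time, with rate the sum of the two errors
(`IsApproxSolution.norm_sub_le_mul`).

*Synchronization gives a common zero.* A convex function with nonempty bounded set of minimizers is
coercive (`isBounded_sublevel_of_isBounded_argmin`), so the potential has a minimizer, which is an
equilibrium of the network (`exists_equilibrium`). The constant solution there synchronizes only if
all its components are equal; then the coupling vanishes and the common component is a zero of every
`f i`.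

*A common zero gives synchronization.* If `z` is a common zero, then `V = ∑ i, ‖x i - z‖ ^ 2`
satisfies `V' ≤ -K W` with the disagreement `W = ∑ i, ∑ j, w i j * ‖x i - x j‖ ^ 2`. The trajectory
is bounded, so `W'` is bounded, and a Barbalat-type argument (`tendsto_zero_of_lyapunov`) gives
`W → 0`. Connectedness carries this from edges to all pairs of nodes. Every Carathéodory solution is
a classical one (`hasDerivAt_of_absolutelyContinuous`), so ordinary derivatives suffice.
-/

namespace NetSync

/-! ### Dissipative differential equations -/

section Dissipative

variable {E : Type*} [NormedAddCommGroup E] [InnerProductSpace ℝ E]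

/-- `y`, with derivative `y'`, solves `y' = A y`, `y 0 = x₀` on `[0, T]` up to an error of norm at
most `ε` in the equation. -/
structure IsApproxSolution (A : E → E) (x₀ : E) (ε T : ℝ) (y y' : ℝ → E) : Prop where
  initial : y 0 = x₀
  hasDerivWithinAt : ∀ t ∈ Icc 0 T, HasDerivWithinAt y (y' t) (Icc 0 T) t
  error_le : ∀ t ∈ Icc 0 T, ‖y' t - A (y t)‖ ≤ ε

/-- Integration of `‖u‖' ≤ c`, the hypothesis being stated in a form that makes sense also at the
zeros of `u`. -/
theorem norm_le_mul_of_inner_deriv_le {u u' : ℝ → E} {c T : ℝ} (hc : 0 ≤ c) (h0 : u 0 = 0)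
    (hu : ∀ t ∈ Icc 0 T, HasDerivWithinAt u (u' t) (Icc 0 T) t)
    (hle : ∀ t ∈ Icc 0 T, inner ℝ (u t) (u' t) ≤ c * ‖u t‖) :
    ∀ t ∈ Icc 0 T, ‖u t‖ ≤ c * t := by
  -- `‖u‖ ^ 2` stays below the square of the strictly faster `(c + η) t + η`.
  have key : ∀ η > 0, ∀ t ∈ Icc 0 T, ‖u t‖ ≤ (c + η) * t + η := by
    intro η hη t ht
    have hpos : ∀ s ∈ Icc 0 T, 0 < (c + η) * s + η := fun s hs => by
      have := hs.1; positivity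
    have hB : ∀ s : ℝ, HasDerivAt (fun s => ((c + η) * s + η) ^ 2)
        (2 * ((c + η) * s + η) * (c + η)) s := by
      intro s
      have h1 : HasDerivAt (fun s : ℝ => (c + η) * s + η) (c + η) s := by
        simpa using ((hasDerivAt_id s).const_mul (c + η)).add_const η
      simpa using h1.fun_pow 2
    have hsq := image_le_of_deriv_right_lt_deriv_boundary' (f := fun t => ‖u t‖ ^ 2)
      (f' := fun t => 2 * inner ℝ (u t) (u' t)) (a := 0) (b := T)
      (fun s hs => ((hu s hs).continuousWithinAt.norm.pow 2))
      (fun s hs => ((hu s (Ico_subset_Icc_self hs)).norm_sq).mono_of_mem_nhdsWithin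
        (Icc_mem_nhdsGE_of_mem hs))
      (B := fun s => ((c + η) * s + η) ^ 2) (B' := fun s => 2 * ((c + η) * s + η) * (c + η))
      (by simp only [h0, norm_zero, mul_zero, zero_add]; nlinarith [sq_nonneg η])
      (fun s _ => (hB s).continuousAt.continuousWithinAt)
      (fun s _ => (hB s).hasDerivWithinAt)
      (fun s hs heq => by
        have hs' := Ico_subset_Icc_self hs
        have hp := hpos s hs'
        have hn : ‖u s‖ = (c + η) * s + η :=
          (pow_left_inj₀ (norm_nonneg _) hp.le two_ne_zero).1 heq
        have := hle s hs'
        rw [hn] at this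
        nlinarith) ht
    exact (pow_le_pow_iff_left₀ (norm_nonneg _) (hpos t ht).le two_ne_zero).1 hsq
  intro t ht
  refine le_of_forall_pos_le_add fun δ hδ => ?_
  have ht1 : 0 < t + 1 := by linarith [ht.1]
  have := key (δ / (t + 1)) (by positivity) t ht
  have h2 : (c + δ / (t + 1)) * t + δ / (t + 1) = c * t + δ := by field_simp; ring
  linarith

/-- Two approximate solutions of a dissipative equation separate at most at the rate given by their
errors: dissipativity contributes nothing to the growth of their distance. -/
theorem IsApproxSolution.norm_sub_le_mul {A : E → E} {x₀ : E} {ε δ S T R : ℝ} {y y' z z' : ℝ → E}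
    (hmono : ∀ x y, inner ℝ (A x - A y) (x - y) ≤ 0)
    (hy : IsApproxSolution A x₀ ε S y y') (hz : IsApproxSolution A x₀ δ T z z')
    (hε : 0 ≤ ε) (hδ : 0 ≤ δ) (hRS : R ≤ S) (hRT : R ≤ T) :
    ∀ t ∈ Icc 0 R, ‖y t - z t‖ ≤ (ε + δ) * t := by
  refine norm_le_mul_of_inner_deriv_le (u' := fun t => y' t - z' t) (add_nonneg hε hδ)
    (by rw [hy.initial, hz.initial, sub_self]) (fun t ht => ?_) (fun t ht => ?_)
  · exact ((hy.hasDerivWithinAt t (Icc_subset_Icc_right hRS ht)).mono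
      (Icc_subset_Icc_right hRS)).sub
      ((hz.hasDerivWithinAt t (Icc_subset_Icc_right hRT ht)).mono (Icc_subset_Icc_right hRT))
  · have e1 := hy.error_le t (Icc_subset_Icc_right hRS ht)
    have e2 := hz.error_le t (Icc_subset_Icc_right hRT ht)
    have hsplit : y' t - z' t
        = (A (y t) - A (z t)) + ((y' t - A (y t)) - (z' t - A (z t))) := by abel
    rw [hsplit, inner_add_right]
    have h1 := hmono (y t) (z t)
    rw [real_inner_comm] at h1
    have h2 := real_inner_le_norm (y t - z t) ((y' t - A (y t)) - (z' t - A (z t)))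
    have h3 := norm_sub_le (y' t - A (y t)) (z' t - A (z t))
    nlinarith [norm_nonneg (y t - z t)]

variable [FiniteDimensional ℝ E]

/-- Cut `A` off outside a large ball, smooth it, and solve by the Picard–Lindelöf theorem.
Dissipativity, which survives the cutoff in the form
`⟪χ x • A x, x - x₀⟫ ≤ ‖A x₀‖ ‖x - x₀‖`, keeps the solution in the ball where nothing was cut. -/
theorem exists_isApproxSolution {A : E → E} (hmono : ∀ x y, inner ℝ (A x - A y) (x - y) ≤ 0)
    (hA : Continuous A) (x₀ : E) {ε T : ℝ} (hε : 0 < ε) (hT : 0 ≤ T) :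
    ∃ y y', IsApproxSolution A x₀ ε T y y' := by
  -- The solution of the modified equation moves by at most `(ε + ‖A x₀‖) * T`.
  set R : ℝ := (ε + ‖A x₀‖) * T + 1
  have hRpos : 0 < R := by positivity
  let χ : ContDiffBump x₀ := ⟨R, R + 1, hRpos, by linarith⟩
  have hGc : Continuous fun x => χ x • A x := χ.continuous.smul hA
  have hGs : HasCompactSupport fun x => χ x • A x := χ.hasCompactSupport.smul_right
  obtain ⟨M, hM⟩ := hGs.exists_bound_of_continuous hGc
  have hM0 : 0 ≤ M := (norm_nonneg _).trans (hM x₀)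
  obtain ⟨B, hB, hBG⟩ :=
    (hGs.uniformContinuous_of_continuous hGc).exists_contDiff_dist_le hε
  have hBG' : ∀ x, ‖B x - χ x • A x‖ ≤ ε := fun x => by
    rw [← dist_eq_norm]; exact (hBG x).le
  have hBM : ∀ x, ‖B x‖ ≤ M + ε := fun x => by
    have := norm_add_le (B x - χ x • A x) (χ x • A x)
    rw [sub_add_cancel] at this
    linarith [hM x, hBG' x]
  let L : NNReal := ⟨M + ε, by positivity⟩
  let r : NNReal := ⟨(M + ε) * T, by positivity⟩
  obtain ⟨k, hk⟩ := (hB.contDiffOn (s := Metric.closedBall x₀ r)).exists_lipschitzOnWith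
    (by simp) (convex_closedBall _ _) (isCompact_closedBall _ _)
  have hPL : IsPicardLindelof (fun _ => B) (tmin := 0) (tmax := T) ⟨0, le_rfl, hT⟩ x₀ r 0 L k :=
    .of_time_independent (fun x _ => hBM x) hk (by
      change (M + ε) * max (T - 0) (0 - 0) ≤ (M + ε) * T - 0
      simp [hT])
  obtain ⟨y, hy0, hy⟩ := hPL.exists_eq_forall_mem_Icc_hasDerivWithinAt₀
  have hball : ∀ t ∈ Icc 0 T, ‖y t - x₀‖ ≤ (ε + ‖A x₀‖) * t := by
    refine norm_le_mul_of_inner_deriv_le (u' := fun t => B (y t)) (by positivity)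
      (by simpa using sub_eq_zero.2 hy0) (fun t ht => (hy t ht).sub_const _) (fun t _ => ?_)
    have hsplit : B (y t) = (B (y t) - χ (y t) • A (y t))
        + χ (y t) • ((A (y t) - A x₀) + A x₀) := by rw [sub_add_cancel, sub_add_cancel]
    rw [hsplit, inner_add_right, inner_smul_right, inner_add_right]
    have h1 := hmono (y t) x₀
    rw [real_inner_comm] at h1
    have h2 := real_inner_le_norm (y t - x₀) (B (y t) - χ (y t) • A (y t))
    have h3 := real_inner_le_norm (y t - x₀) (A x₀)
    have h4 := mul_le_mul_of_nonneg_left (hBG' (y t)) (norm_nonneg (y t - x₀))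
    have h5 : χ (y t) * (inner ℝ (y t - x₀) (A (y t) - A x₀) + inner ℝ (y t - x₀) (A x₀))
        ≤ χ (y t) * (‖y t - x₀‖ * ‖A x₀‖) :=
      mul_le_mul_of_nonneg_left (by linarith) χ.nonneg
    have h6 := mul_le_of_le_one_left
      (mul_nonneg (norm_nonneg (y t - x₀)) (norm_nonneg (A x₀))) (χ.le_one (x := y t))
    linarith
  refine ⟨y, fun t => B (y t), hy0, hy, fun t ht => ?_⟩
  have hmem : y t ∈ Metric.closedBall x₀ χ.rIn := by
    rw [mem_closedBall_iff_norm]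
    have := mul_le_mul_of_nonneg_left ht.2 (by positivity : 0 ≤ ε + ‖A x₀‖)
    change _ ≤ R
    linarith [hball t ht]
  simpa [χ.one_of_mem_closedBall hmem] using hBG' (y t)

theorem exists_tendstoUniformlyOn_Icc {y : ℕ → ℝ → E}
    (hy : ∀ n k : ℕ, ∀ t : ℝ, 0 ≤ t → t ≤ n → t ≤ k →
      ‖y n t - y k t‖ ≤ (1 / ((n : ℝ) + 1) + 1 / ((k : ℝ) + 1)) * t) :
    ∃ x : ℝ → E, ∀ T : ℝ, TendstoUniformlyOn y x atTop (Icc 0 T) := by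
  have hlim : Tendsto (fun n : ℕ => 1 / ((n : ℝ) + 1)) atTop (𝓝 0) :=
    tendsto_one_div_add_atTop_nhds_zero_nat
  have hcauchy : ∀ T : ℝ, UniformCauchySeqOn y atTop (Icc 0 T) := by
    intro T
    rw [Metric.uniformCauchySeqOn_iff]
    intro δ hδ
    obtain ⟨n₀, hn₀⟩ := exists_nat_ge T
    have hsm : ∀ᶠ n : ℕ in atTop, 1 / ((n : ℝ) + 1) * T < δ / 2 :=
      (by simpa using hlim.mul_const T :
        Tendsto (fun n : ℕ => 1 / ((n : ℝ) + 1) * T) atTop (𝓝 0)).eventually_lt_const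
          (half_pos hδ)
    obtain ⟨n₁, hn₁⟩ := eventually_atTop.1 (hsm.and (eventually_ge_atTop n₀))
    refine ⟨n₁, fun n hn k hk t ht => ?_⟩
    obtain ⟨hn1, hn2⟩ := hn₁ n hn
    obtain ⟨hk1, hk2⟩ := hn₁ k hk
    have hTn : T ≤ n := hn₀.trans (by exact_mod_cast hn2)
    have hTk : T ≤ k := hn₀.trans (by exact_mod_cast hk2)
    rw [dist_eq_norm]
    have h1 := hy n k t ht.1 (ht.2.trans hTn) (ht.2.trans hTk)
    have h2 : (1 / ((n : ℝ) + 1) + 1 / ((k : ℝ) + 1)) * t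
        ≤ (1 / ((n : ℝ) + 1) + 1 / ((k : ℝ) + 1)) * T :=
      mul_le_mul_of_nonneg_left ht.2 (by positivity)
    linarith
  have hex : ∀ t, ∃ p, 0 ≤ t → Tendsto (fun n => y n t) atTop (𝓝 p) := by
    intro t
    by_cases ht : 0 ≤ t
    · obtain ⟨p, hp⟩ := cauchySeq_tendsto_of_complete ((hcauchy t).cauchySeq ⟨ht, le_rfl⟩)
      exact ⟨p, fun _ => hp⟩
    · exact ⟨0, fun h => absurd h ht⟩
  choose x hx using hex
  exact ⟨x, fun T => (hcauchy T).tendstoUniformlyOn_of_tendsto fun t ht => hx t ht.1⟩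

/-- **Global existence for continuous dissipative vector fields.** The approximate solutions with
error `1 / (n + 1)` on `[0, n]` form a Cauchy sequence, locally uniformly in time. -/
theorem exists_solution_of_dissipative {A : E → E}
    (hmono : ∀ x y, inner ℝ (A x - A y) (x - y) ≤ 0) (hA : Continuous A) (x₀ : E) :
    ∃ x : ℝ → E, x 0 = x₀ ∧ ContinuousOn x (Ici 0) ∧
      ∀ t, 0 < t → HasDerivAt x (A (x t)) t := by
  have hε : ∀ n : ℕ, 0 < 1 / ((n : ℝ) + 1) := fun n => by positivity
  choose y y' hy using fun n : ℕ =>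
    exists_isApproxSolution hmono hA x₀ (hε n) (Nat.cast_nonneg n : (0 : ℝ) ≤ n)
  obtain ⟨x, hunif⟩ := exists_tendstoUniformlyOn_Icc fun n k t h0 hn hk =>
    (hy n).norm_sub_le_mul hmono (hy k) (hε n).le (hε k).le hn hk t ⟨h0, le_rfl⟩
  have hcont : ContinuousOn x (Ici 0) := by
    intro t ht
    have ht' : t < t + 1 := lt_add_one t
    have hIcc : ContinuousOn x (Icc 0 (t + 1)) := by
      refine (hunif (t + 1)).continuousOn (Eventually.frequently ?_)
      obtain ⟨n₀, hn₀⟩ := exists_nat_ge (t + 1)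
      filter_upwards [eventually_ge_atTop n₀] with n hn s hs
      have hsub : Icc 0 (t + 1) ⊆ Icc 0 (n : ℝ) :=
        Icc_subset_Icc_right (hn₀.trans (by exact_mod_cast hn))
      exact ((hy n).hasDerivWithinAt s (hsub hs)).continuousWithinAt.mono hsub
    have ht0 : (0 : ℝ) ≤ t := ht
    exact (hIcc t ⟨ht0, ht'.le⟩).mono_of_mem_nhdsWithin
      (mem_nhdsWithin.2 ⟨Iio (t + 1), isOpen_Iio, ht', fun s hs => ⟨hs.2, le_of_lt hs.1⟩⟩)
  refine ⟨x, ?_, hcont, fun t ht => ?_⟩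
  · refine tendsto_nhds_unique ((hunif 0).tendsto_at (left_mem_Icc.2 le_rfl)) ?_
    simp [(hy _).initial]
  obtain ⟨n₀, hn₀⟩ := exists_nat_gt (t + 1)
  have hnear : ∀ᶠ p : ℕ × ℝ in atTop ×ˢ 𝓝 t, p.2 ∈ Ioo 0 (p.1 : ℝ) := by
    filter_upwards [(eventually_ge_atTop n₀).prod_mk
      (Ioo_mem_nhds ht (lt_add_one t))] with p hp
    have : (n₀ : ℝ) ≤ p.1 := by exact_mod_cast hp.1
    exact ⟨hp.2.1, by linarith [hp.2.2]⟩
  have hxt : ContinuousAt x t := hcont.continuousAt (Ici_mem_nhds ht)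
  refine hasDerivAt_of_tendstoUniformlyOnFilter (l := atTop) (f := y) (f' := y')
    (g' := fun s => A (x s)) ?_ ?_ ?_
  · -- `y n s → x t` jointly in `(n, s)`, so `A (y n s)` and `A (x s)` have the same limit.
    have hu : TendstoUniformlyOnFilter y x atTop (𝓝 t) :=
      ((hunif (t + 1)).tendstoUniformlyOnFilter).mono_right
        (le_principal_iff.2 (Icc_mem_nhds ht (lt_add_one t)))
    have hx2 : Tendsto (fun p : ℕ × ℝ => x p.2) (atTop ×ˢ 𝓝 t) (𝓝 (x t)) :=
      hxt.tendsto.comp tendsto_snd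
    have hyx : Tendsto (fun p : ℕ × ℝ => y p.1 p.2) (atTop ×ˢ 𝓝 t) (𝓝 (x t)) := by
      refine hx2.congr_dist ?_
      rw [Metric.tendsto_nhds]
      intro δ hδ
      filter_upwards [Metric.tendstoUniformlyOnFilter_iff.1 hu δ hδ] with p hp
      simpa using hp
    have hAlim : Tendsto (fun p : ℕ × ℝ => dist (A (x p.2)) (A (y p.1 p.2)) + 1 / ((p.1 : ℝ) + 1))
        (atTop ×ˢ 𝓝 t) (𝓝 0) := by
      simpa using (((hA.tendsto _).comp hx2).dist ((hA.tendsto _).comp hyx)).add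
        (tendsto_one_div_add_atTop_nhds_zero_nat.comp tendsto_fst)
    rw [Metric.tendstoUniformlyOnFilter_iff]
    intro δ hδ
    filter_upwards [hnear, hAlim.eventually_lt_const hδ] with p hp hlt
    refine (dist_triangle _ (A (y p.1 p.2)) _).trans_lt (lt_of_le_of_lt ?_ hlt)
    rw [dist_comm (A (y p.1 p.2)), dist_eq_norm (y' p.1 p.2)]
    exact add_le_add_right ((hy p.1).error_le p.2 (Ioo_subset_Icc_self hp)) _
  · filter_upwards [hnear] with p hp
    exact ((hy p.1).hasDerivWithinAt p.2 (Ioo_subset_Icc_self hp)).hasDerivAt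
      (Icc_mem_nhds hp.1 hp.2)
  · filter_upwards [Ioi_mem_nhds ht] with s hs
    exact (hunif s).tendsto_at ⟨le_of_lt hs, le_rfl⟩

end Dissipative

/-! ### Carathéodory and classical solutions -/

section Regularity

variable {E : Type*} [NormedAddCommGroup E] [NormedSpace ℝ E]

theorem absolutelyContinuousOnInterval_of_hasDerivAt {x v : ℝ → E} {T : ℝ} (hT : 0 ≤ T)
    (hx : ContinuousOn x (Ici 0)) (hv : ContinuousOn v (Ici 0))
    (hd : ∀ t, 0 < t → HasDerivAt x (v t) t) : AbsolutelyContinuousOnInterval x 0 T := by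
  obtain ⟨C, hC⟩ := isCompact_Icc.exists_bound_of_continuousOn
    (hv.mono (Icc_subset_Ici_self : Icc 0 T ⊆ Ici 0))
  have hL : LipschitzOnWith C.toNNReal x (Ioo 0 T) :=
    (convex_Ioo 0 T).lipschitzOnWith_of_nnnorm_hasDerivWithin_le
      (fun t ht => (hd t ht.1).hasDerivWithinAt) fun t ht => by
        rw [← NNReal.coe_le_coe, coe_nnnorm]
        exact (hC t (Ioo_subset_Icc_self ht)).trans (Real.le_coe_toNNReal C)
  refine LipschitzOnWith.absolutelyContinuousOnInterval (K := C.toNNReal) ?_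
  rw [uIcc_of_le hT]
  rcases hT.eq_or_lt with rfl | hT
  · rw [Icc_self]; exact fun s hs t ht => by simp [mem_singleton_iff.1 hs, mem_singleton_iff.1 ht]
  · have hcl : closure (Ioo 0 T) = Icc 0 T := closure_Ioo hT.ne
    rw [← hcl]
    exact hL.closure (hx.mono (hcl ▸ Icc_subset_Ici_self))

/-- A Carathéodory solution of an equation with continuous right-hand side is a classical one:
by the fundamental theorem of calculus it is a primitive of the continuous function `v`. -/
theorem hasDerivAt_of_absolutelyContinuous [CompleteSpace E] {x v : ℝ → E}
    (hx : ∀ T, 0 ≤ T → AbsolutelyContinuousOnInterval x 0 T) (hv : ContinuousOn v (Ici 0))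
    (hd : ∀ᵐ t : ℝ, 0 < t → HasDerivAt x (v t) t) {t : ℝ} (ht : 0 < t) :
    HasDerivAt x (v t) t := by
  -- `u` extends `v` continuously to negative times.
  set u : ℝ → E := fun s => v (max s 0) with hu
  have huc : Continuous u :=
    hv.comp_continuous (continuous_id.max continuous_const) fun s => mem_Ici.2 (le_max_right s 0)
  have huv : ∀ s, 0 ≤ s → u s = v s := fun s hs => by simp [hu, hs]
  have hX : ∀ s, HasDerivAt (fun s => ∫ r in (0 : ℝ)..s, u r) (u s) s := fun s =>
    (huc.integral_hasStrictDerivAt 0 s).hasDerivAt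
  have hXac : AbsolutelyContinuousOnInterval (fun s => ∫ r in (0 : ℝ)..s, u r) 0 (t + 1) :=
    absolutelyContinuousOnInterval_of_hasDerivAt (by positivity)
      (fun s _ => (hX s).continuousAt.continuousWithinAt) huc.continuousOn fun s _ => hX s
  obtain ⟨C, hC⟩ := ((hx (t + 1) (by positivity)).sub hXac).const_of_ae_hasDerivAt_zero (by
    filter_upwards [hd, Measure.ae_ne volume 0] with s hs hs0 hmem
    rw [uIcc_of_le (by positivity)] at hmem
    have hpos : 0 < s := lt_of_le_of_ne hmem.1 (Ne.symm hs0)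
    simpa [huv s hpos.le] using (hs hpos).sub (hX s))
  have hev : (fun s => ∫ r in (0 : ℝ)..s, u r) + (fun _ => C) =ᶠ[𝓝 t] x := by
    filter_upwards [Ioo_mem_nhds ht (lt_add_one t)] with s hs
    have := hC s (by rw [uIcc_of_le (by positivity)]; exact Ioo_subset_Icc_self hs)
    simp only [Pi.sub_apply] at this
    simp [← this]
  rw [← huv t ht.le]
  simpa using ((hX t).add (hasDerivAt_const t C)).congr_of_eventuallyEq hev.symm

end Regularity

/-! ### Convex functions and their gradients -/

section Convex

variable {E : Type*} [NormedAddCommGroup E] [InnerProductSpace ℝ E] [CompleteSpace E]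

theorem add_inner_gradient_le {F : E → ℝ} {g x : E} (hF : ConvexOn ℝ univ F)
    (hg : HasGradientAt F g x) (y : E) : F x + inner ℝ g (y - x) ≤ F y := by
  have hline : HasDerivAt (fun s : ℝ => AffineMap.lineMap x y s) (y - x) 0 := by
    simpa using AffineMap.hasDerivAt_lineMap (a := x) (b := y) (x := (0 : ℝ))
  have hd : HasDerivAt (F ∘ fun s : ℝ => AffineMap.lineMap x y s) (inner ℝ g (y - x)) 0 := by
    have h := (hasGradientAt_iff_hasFDerivAt.1 hg)
    have h' : HasFDerivAt F (InnerProductSpace.toDual ℝ E g) (AffineMap.lineMap x y (0 : ℝ)) := by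
      simpa using h
    simpa using h'.comp_hasDerivAt 0 hline
  have hc : ConvexOn ℝ univ (F ∘ fun s : ℝ => AffineMap.lineMap x y s) :=
    hF.comp_affineMap (AffineMap.lineMap x y)
  have := hc.le_slope_of_hasDerivAt (mem_univ 0) (mem_univ 1) one_pos hd
  simp [slope_def_field] at this
  linarith

theorem inner_gradient_sub_nonneg {F : E → ℝ} {g h x y : E} (hF : ConvexOn ℝ univ F)
    (hg : HasGradientAt F g x) (hh : HasGradientAt F h y) : 0 ≤ inner ℝ (g - h) (x - y) := by
  have h1 := add_inner_gradient_le hF hg y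
  have h2 := add_inner_gradient_le hF hh x
  have h3 : inner ℝ g (y - x) = - inner ℝ g (x - y) := by rw [← inner_neg_right, neg_sub]
  rw [inner_sub_left]
  linarith

theorem continuous_gradient {F : E → ℝ} (hF : ContDiff ℝ 1 F) : Continuous (gradient F) :=
  (InnerProductSpace.toDual ℝ E).symm.continuous.comp (hF.continuous_fderiv one_ne_zero)

end Convex

/-- A convex function whose set of minimizers is bounded is coercive: on a sphere around the
minimizers it exceeds its minimum by some `δ`, and by convexity it grows at least linearly from
there on. -/
theorem isBounded_sublevel_of_isBounded_argmin {E : Type*} [NormedAddCommGroup E]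
    [NormedSpace ℝ E] [FiniteDimensional ℝ E] {F : E → ℝ} (hF : ConvexOn ℝ univ F)
    (hcont : Continuous F) {z₀ : E} (hbdd : Bornology.IsBounded {z | F z ≤ F z₀}) (c : ℝ) :
    Bornology.IsBounded {z | F z ≤ c} := by
  obtain ⟨R, hR0, hR⟩ := hbdd.subset_ball_lt 0 z₀
  have hδ : ∃ δ > 0, ∀ y ∈ Metric.sphere z₀ R, F z₀ + δ ≤ F y := by
    rcases (Metric.sphere z₀ R).eq_empty_or_nonempty with he | hne
    · exact ⟨1, one_pos, by simp [he]⟩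
    obtain ⟨y, hy, hmin⟩ := (isCompact_sphere z₀ R).exists_isMinOn hne hcont.continuousOn
    refine ⟨F y - F z₀, ?_, fun w hw => by have := isMinOn_iff.1 hmin w hw; linarith⟩
    by_contra hle
    have hmem : y ∈ Metric.ball z₀ R := hR (by simpa using hle)
    rw [Metric.mem_ball, Metric.mem_sphere.1 hy] at hmem
    exact lt_irrefl _ hmem
  obtain ⟨δ, hδ0, hδ⟩ := hδ
  refine (Metric.isBounded_closedBall (x := z₀) (r := max R (R * (c - F z₀) / δ))).subset
    fun z hz => ?_
  rw [mem_closedBall_iff_norm]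
  by_contra! hlt
  have hz : F z ≤ c := hz
  obtain ⟨h1, h2⟩ := max_lt_iff.1 hlt
  set d := ‖z - z₀‖ with hd
  have hd0 : 0 < d := hR0.trans h1
  have hq0 : 0 ≤ R / d := by positivity
  have hq1 : R / d ≤ 1 := (div_le_one hd0).2 h1.le
  have hy : (1 - R / d) • z₀ + (R / d) • z ∈ Metric.sphere z₀ R := by
    rw [mem_sphere_iff_norm]
    have : (1 - R / d) • z₀ + (R / d) • z - z₀ = (R / d) • (z - z₀) := by module
    rw [this, norm_smul, Real.norm_of_nonneg hq0, ← hd]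
    field_simp
  have h3 := hδ _ hy
  have h4 := hF.2 (mem_univ z₀) (mem_univ z) (sub_nonneg.2 hq1) hq0 (by ring)
  simp only [smul_eq_mul] at h4
  have h5 : δ ≤ R / d * (c - F z₀) := by
    nlinarith [mul_le_mul_of_nonneg_left hz hq0]
  have h6 : R / d * (c - F z₀) = R * (c - F z₀) / d := by ring
  rw [h6, le_div_iff₀ hd0] at h5
  rw [div_lt_iff₀ hδ0] at h2
  linarith

/-! ### A Barbalat-type lemma -/

theorem antitoneOn_Ici_of_hasDerivAt_nonpos {φ φ' : ℝ → ℝ} {T : ℝ} (hT : 0 < T)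
    (hd : ∀ t, 0 < t → HasDerivAt φ (φ' t) t) (hle : ∀ t, T ≤ t → φ' t ≤ 0) :
    AntitoneOn φ (Ici T) := by
  have hpos : ∀ t ∈ Ici T, 0 < t := fun t ht => hT.trans_le ht
  refine antitoneOn_of_deriv_nonpos (convex_Ici T)
    (fun t ht => (hd t (hpos t ht)).continuousAt.continuousWithinAt)
    (fun t ht => (hd t (hpos t (interior_subset ht))).differentiableAt.differentiableWithinAt)
    fun t ht => ?_
  rw [(hd t (hpos t (interior_subset ht))).deriv]
  exact hle t (interior_subset ht)

theorem exists_tendsto_of_antitoneOn_Ici {φ : ℝ → ℝ} {T b : ℝ} (hφ : AntitoneOn φ (Ici T))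
    (hb : ∀ t, T ≤ t → b ≤ φ t) : ∃ l, Tendsto φ atTop (𝓝 l) := by
  have hanti : Antitone fun t => φ (max t T) := fun s t hst =>
    hφ (le_max_right s T) (le_max_right t T) (max_le_max_right T hst)
  have hbdd : BddBelow (range fun t => φ (max t T)) :=
    ⟨b, by rintro _ ⟨t, rfl⟩; exact hb _ (le_max_right t T)⟩
  refine ⟨_, (tendsto_atTop_ciInf hanti hbdd).congr' ?_⟩
  filter_upwards [eventually_ge_atTop T] with t ht
  rw [max_eq_left ht]

/-- If a nonnegative `V` decreases at rate at least `k W`, where `W ≥ 0` has derivative bounded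
above, then `W → 0`. Both `V` and `k W² + 2 C V` are nonincreasing, so `W²` converges; a positive
limit would make `V` negative eventually. -/
theorem tendsto_zero_of_lyapunov {V V' W W' : ℝ → ℝ} {k C : ℝ} (hk : 0 < k)
    (hV : ∀ t, 0 < t → HasDerivAt V (V' t) t) (hW : ∀ t, 0 < t → HasDerivAt W (W' t) t)
    (hV0 : ∀ t, 0 ≤ V t) (hW0 : ∀ t, 0 ≤ W t) (hVW : ∀ t, 0 < t → V' t ≤ -(k * W t))
    (hC : ∀ t, 1 ≤ t → W' t ≤ C) : Tendsto W atTop (𝓝 0) := by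
  wlog hC0 : 0 ≤ C generalizing C
  · exact this (fun t ht => (hC t ht).trans (le_max_left C 0)) (le_max_right C 0)
  obtain ⟨l₁, hl₁⟩ := exists_tendsto_of_antitoneOn_Ici (antitoneOn_Ici_of_hasDerivAt_nonpos
    one_pos hV fun t ht => (hVW t (one_pos.trans_le ht)).trans
      (neg_nonpos.2 (mul_nonneg hk.le (hW0 t)))) fun t _ => hV0 t
  have hQ : ∀ t, 0 < t → HasDerivAt (fun t => k * W t ^ 2 + 2 * C * V t)
      (k * (2 * W t * W' t) + 2 * C * V' t) t := fun t ht => by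
    simpa using (((hW t ht).fun_pow 2).const_mul k).fun_add ((hV t ht).const_mul (2 * C))
  obtain ⟨l₂, hl₂⟩ := exists_tendsto_of_antitoneOn_Ici (b := 0)
    (antitoneOn_Ici_of_hasDerivAt_nonpos one_pos hQ fun t ht => by
      have ht0 := one_pos.trans_le ht
      have h1 := mul_le_mul_of_nonneg_left (hVW t ht0) hC0
      have h2 := mul_le_mul_of_nonneg_left (hC t ht) (mul_nonneg hk.le (hW0 t))
      linarith) fun t _ => by
      have := hV0 t
      positivity
  have hsq : Tendsto (fun t => W t ^ 2) atTop (𝓝 ((l₂ - 2 * C * l₁) / k)) := by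
    refine ((hl₂.sub (hl₁.const_mul (2 * C))).div_const k).congr fun t => ?_
    field_simp
    ring
  have hlim : Tendsto W atTop (𝓝 √((l₂ - 2 * C * l₁) / k)) :=
    (hsq.sqrt).congr fun t => Real.sqrt_sq (hW0 t)
  have hl : 0 ≤ √((l₂ - 2 * C * l₁) / k) := Real.sqrt_nonneg _
  generalize √((l₂ - 2 * C * l₁) / k) = l at hlim hl
  rcases hl.eq_or_lt with h0 | hpos
  · rwa [← h0] at hlim
  exfalso
  obtain ⟨T, hT⟩ := eventually_atTop.1 (hlim.eventually_const_le (half_lt_self hpos))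
  have hT1 : 0 < max T 1 := lt_max_of_lt_right one_pos
  have hanti : AntitoneOn (fun t => V t + k * (l / 2) * t) (Ici (max T 1)) :=
    antitoneOn_Ici_of_hasDerivAt_nonpos hT1
      (fun t ht => (hV t ht).add (by simpa using (hasDerivAt_id t).const_mul (k * (l / 2))))
      fun t ht => by
        have h1 := hVW t (hT1.trans_le ht)
        have h2 := mul_le_mul_of_nonneg_left (hT t ((le_max_left _ _).trans ht)) hk.le
        linarith
  -- From time `T` on, `V` loses at least `k l / 2` per unit of time.
  have hle : max T 1 ≤ max T 1 + (V (max T 1) + 1) / (k * (l / 2)) := by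
    have := hV0 (max T 1)
    simp only [le_add_iff_nonneg_right]
    positivity
  have hstep := hanti self_mem_Ici (mem_Ici.2 hle) hle
  have hne : k * (l / 2) ≠ 0 := by positivity
  simp only [mul_add, mul_div_cancel₀ _ hne] at hstep
  linarith [hV0 (max T 1 + (V (max T 1) + 1) / (k * (l / 2)))]

/-! ### The coupled network -/

section Network

variable {N m : ℕ} {f : Fin N → State m → State m} {G : SimpleGraph (Fin N)}
  {a : Fin N → Fin N → ℝ} {K : ℝ}

open Classical in
/-- The edge weights, extended by zero to pairs of nodes that are not adjacent; thus sums over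
neighbors become sums over all nodes. -/
noncomputable def weight (G : SimpleGraph (Fin N)) (a : Fin N → Fin N → ℝ) (i j : Fin N) : ℝ :=
  if G.Adj i j then a i j else 0

theorem weight_of_adj {i j : Fin N} (h : G.Adj i j) : weight G a i j = a i j := if_pos h

theorem weight_nonneg (ha : ∀ i j, G.Adj i j → 0 < a i j) (i j : Fin N) : 0 ≤ weight G a i j := by
  unfold weight
  split_ifs with h
  exacts [(ha i j h).le, le_rfl]

theorem weight_comm (ha : ∀ i j, G.Adj i j → a i j = a j i) (i j : Fin N) :
    weight G a i j = weight G a j i := by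
  by_cases h : G.Adj i j
  · rw [weight_of_adj h, weight_of_adj h.symm, ha i j h]
  · rw [weight, weight, if_neg h, if_neg fun h' => h h'.symm]

theorem rhs_eq (y : Fin N → State m) (i : Fin N) :
    rhs f G a K y i = f i (y i) + K • ∑ j, weight G a i j • (y j - y i) := by
  simp only [rhs, weight, SimpleGraph.neighborFinset_eq_filter, Finset.sum_filter, ite_smul,
    zero_smul]

theorem continuous_rhs (hf : ∀ i, Continuous (f i)) (i : Fin N) :
    Continuous fun y => rhs f G a K y i := by
  simp only [rhs_eq]
  have := hf i
  fun_prop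

theorem sum_inner_coupling {w : Fin N → Fin N → ℝ} (hw : ∀ i j, w i j = w j i)
    (y v : Fin N → State m) :
    ∑ i, inner ℝ (∑ j, w i j • (y j - y i)) (v i)
      = -(1 / 2) * ∑ i, ∑ j, w i j * inner ℝ (y i - y j) (v i - v j) := by
  have h1 : ∑ i, inner ℝ (∑ j, w i j • (y j - y i)) (v i)
      = ∑ i, ∑ j, w i j * inner ℝ (y j - y i) (v i) := by
    simp only [sum_inner, real_inner_smul_left]
  have h2 : ∑ i, ∑ j, w i j * inner ℝ (y j - y i) (v i)
      = ∑ i, ∑ j, w i j * inner ℝ (y i - y j) (v j) := by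
    rw [Finset.sum_comm]
    exact Finset.sum_congr rfl fun i _ => Finset.sum_congr rfl fun j _ => by rw [hw]
  have h3 : ∑ i, ∑ j, w i j * inner ℝ (y i - y j) (v i - v j)
      = -(∑ i, ∑ j, w i j * inner ℝ (y j - y i) (v i))
        - ∑ i, ∑ j, w i j * inner ℝ (y i - y j) (v j) := by
    simp only [← Finset.sum_neg_distrib, ← Finset.sum_sub_distrib]
    refine Finset.sum_congr rfl fun i _ => Finset.sum_congr rfl fun j _ => ?_
    rw [inner_sub_right, ← neg_sub (y i) (y j), inner_neg_left]
    ring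
  rw [h3, h1, ← h2]
  ring

/-- The network vector field is dissipative, and the coupling contributes the Laplacian quadratic
form of the difference of the two states. -/
theorem sum_inner_rhs_sub_le (hf : ∀ i x y, inner ℝ (f i x - f i y) (x - y) ≤ 0)
    (ha_symm : ∀ i j, G.Adj i j → a i j = a j i) (y z : Fin N → State m) :
    ∑ i, inner ℝ (rhs f G a K y i - rhs f G a K z i) (y i - z i)
      ≤ -(K / 2 * ∑ i, ∑ j, weight G a i j * ‖(y i - z i) - (y j - z j)‖ ^ 2) := by
  have h1 : ∀ i, rhs f G a K y i - rhs f G a K z i = (f i (y i) - f i (z i))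
      + K • ∑ j, weight G a i j • ((y j - z j) - (y i - z i)) := fun i => by
    have : ∑ j, weight G a i j • ((y j - z j) - (y i - z i))
        = ∑ j, weight G a i j • (y j - y i) - ∑ j, weight G a i j • (z j - z i) := by
      rw [← Finset.sum_sub_distrib]
      exact Finset.sum_congr rfl fun j _ => by module
    rw [rhs_eq, rhs_eq, this]
    module
  have h2 := sum_inner_coupling (weight_comm ha_symm) (fun i => y i - z i) (fun i => y i - z i)
  simp only [real_inner_self_eq_norm_sq] at h2
  simp only [h1, inner_add_left, Finset.sum_add_distrib, real_inner_smul_left, ← Finset.mul_sum]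
  rw [h2]
  have h3 := Finset.sum_nonpos fun i (_ : i ∈ Finset.univ) => hf i (y i) (z i)
  linarith

theorem exists_isCaratheodorySolution (hfc : ∀ i, Continuous (f i))
    (hf : ∀ i x y, inner ℝ (f i x - f i y) (x - y) ≤ 0)
    (ha_pos : ∀ i j, G.Adj i j → 0 < a i j) (ha_symm : ∀ i j, G.Adj i j → a i j = a j i)
    (hK : 0 ≤ K) (x₀ : Fin N → State m) : ∃ x, IsCaratheodorySolution f G a K x₀ x := by
  obtain ⟨X, hX0, hXc, hXd⟩ := exists_solution_of_dissipative
    (E := PiLp 2 fun _ : Fin N => State m)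
    (A := fun z => WithLp.toLp 2 fun i => rhs f G a K (WithLp.ofLp z) i)
    (fun y z => by
      have h := sum_inner_rhs_sub_le hf ha_symm (K := K) (WithLp.ofLp y) (WithLp.ofLp z)
      refine (PiLp.inner_apply _ _).trans_le (h.trans (neg_nonpos.2 ?_))
      exact mul_nonneg (by positivity) (Finset.sum_nonneg fun i _ => Finset.sum_nonneg fun j _ =>
        mul_nonneg (weight_nonneg ha_pos i j) (sq_nonneg _)))
    ((PiLp.continuous_toLp 2 _).comp (continuous_pi fun i =>
      (continuous_rhs hfc i).comp (PiLp.continuous_ofLp 2 _)))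
    (WithLp.toLp 2 x₀)
  have hd : ∀ i t, 0 < t →
      HasDerivAt (fun s => X s i) (rhs f G a K (WithLp.ofLp (X t)) i) t := fun i t ht =>
    (PiLp.proj (𝕜 := ℝ) 2 (fun _ : Fin N => State m) i).hasFDerivAt.comp_hasDerivAt t (hXd t ht)
  refine ⟨fun t => WithLp.ofLp (X t), by simp [hX0], fun i T hT => ?_,
    Eventually.of_forall fun t ht i => hd i t ht⟩
  have hXc' : ContinuousOn (fun t => WithLp.ofLp (X t)) (Ici 0) :=
    (PiLp.continuous_ofLp 2 _).comp_continuousOn hXc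
  exact absolutelyContinuousOnInterval_of_hasDerivAt hT (continuousOn_pi.1 hXc' i)
    ((continuous_rhs hfc i).comp_continuousOn hXc') (hd i)

/-! ### Equilibria -/

/-- An equilibrium minimizes the coercive potential
`∑ i, F i (y i) + (K / 4) * ∑ i, ∑ j, w i j * ‖y i - y j‖ ^ 2`, of which the network vector field
is the negative gradient. -/
theorem exists_equilibrium {F : Fin N → State m → ℝ} (hF : ∀ i, ContDiff ℝ 1 (F i))
    (hconv : ∀ i, ConvexOn ℝ univ (F i)) {z : Fin N → State m} (hz : ∀ i y, F i (z i) ≤ F i y)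
    (hfF : ∀ i y, f i y = -gradient (F i) y)
    (hbdd : ∀ i, Bornology.IsBounded (zeroSet (f i)))
    (ha_pos : ∀ i j, G.Adj i j → 0 < a i j) (ha_symm : ∀ i j, G.Adj i j → a i j = a j i)
    (hK : 0 ≤ K) : ∃ y, ∀ i, rhs f G a K y i = 0 := by
  have hgrad : ∀ i y, HasGradientAt (F i) (-f i y) y := fun i y => by
    rw [hfF, neg_neg]
    exact ((hF i).differentiable one_ne_zero y).hasGradientAt
  set Q : (Fin N → State m) → ℝ :=
    fun y => K / 4 * ∑ i, ∑ j, weight G a i j * ‖y i - y j‖ ^ 2 with hQ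
  have hQ0 : ∀ y, 0 ≤ Q y := fun y => mul_nonneg (by positivity) (Finset.sum_nonneg fun i _ =>
    Finset.sum_nonneg fun j _ => mul_nonneg (weight_nonneg ha_pos i j) (sq_nonneg _))
  set Φ : (Fin N → State m) → ℝ := fun y => ∑ i, F i (y i) + Q y with hΦ
  have hΦc : Continuous Φ := by
    have := fun i => (hF i).continuous
    simp only [hΦ, hQ]
    fun_prop
  have hargmin : ∀ i, Bornology.IsBounded {y | F i y ≤ F i (z i)} := fun i => by
    refine (hbdd i).subset fun y hy => ?_
    have hmin : IsLocalMin (F i) y := Eventually.of_forall fun w =>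
      (show F i y ≤ F i (z i) from hy).trans (hz i w)
    have h0 := hmin.hasFDerivAt_eq_zero (hasGradientAt_iff_hasFDerivAt.1 (hgrad i y))
    simpa [zeroSet] using h0
  have hsub : Bornology.IsBounded {y | Φ y ≤ Φ z} := by
    refine (Bornology.IsBounded.pi fun i => isBounded_sublevel_of_isBounded_argmin (hconv i)
      (hF i).continuous (hargmin i) (Q z + F i (z i))).subset fun y hy i _ => ?_
    have h1 : Φ y ≤ Φ z := hy
    have h2 := Finset.single_le_sum (f := fun i => F i (y i) - F i (z i))
      (fun i _ => sub_nonneg.2 (hz i (y i))) (Finset.mem_univ i)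
    rw [Finset.sum_sub_distrib] at h2
    have h3 := hQ0 y
    change F i (y i) ≤ _
    simp only [hΦ] at h1
    linarith
  obtain ⟨y, hy, hymin⟩ := (Metric.isCompact_of_isClosed_isBounded
    (isClosed_le hΦc continuous_const) hsub).exists_isMinOn ⟨z, le_refl (Φ z)⟩ hΦc.continuousOn
  have hmin : ∀ w, Φ y ≤ Φ w := fun w => by
    by_cases hw : Φ w ≤ Φ z
    · exact isMinOn_iff.1 hymin w hw
    · exact le_trans hy (not_le.1 hw).le
  refine ⟨y, ?_⟩
  -- Differentiate the potential at the minimizer in the direction `v` of the vector field itself.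
  set v : Fin N → State m := fun i => rhs f G a K y i with hv
  have hline : ∀ i, HasDerivAt (fun s : ℝ => y i + s • v i) (v i) 0 := fun i => by
    simpa using ((hasDerivAt_id (0 : ℝ)).smul_const (v i)).const_add (y i)
  have hdF : ∀ i, HasDerivAt (fun s : ℝ => F i (y i + s • v i)) (inner ℝ (-f i (y i)) (v i)) 0 :=
    fun i => by
      have h := hasGradientAt_iff_hasFDerivAt.1 (hgrad i (y i + (0 : ℝ) • v i))
      have h' := h.comp_hasDerivAt (0 : ℝ) (hline i)
      simp only [zero_smul, add_zero, InnerProductSpace.toDual_apply_apply] at h'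
      exact h'
  have hdQ : ∀ i j, HasDerivAt (fun s : ℝ => ‖(y i + s • v i) - (y j + s • v j)‖ ^ 2)
      (2 * inner ℝ (y i - y j) (v i - v j)) 0 := fun i j => by
    simpa using ((hline i).fun_sub (hline j)).norm_sq
  have hd : HasDerivAt (fun s : ℝ => Φ fun i => y i + s • v i)
      (∑ i, inner ℝ (-f i (y i)) (v i)
        + K / 4 * ∑ i, ∑ j, weight G a i j * (2 * inner ℝ (y i - y j) (v i - v j))) 0 :=
    (HasDerivAt.fun_sum fun i _ => hdF i).fun_add (HasDerivAt.const_mul _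
      (HasDerivAt.fun_sum fun i _ => HasDerivAt.fun_sum fun j _ => (hdQ i j).const_mul _))
  have hzero := IsLocalMin.hasDerivAt_eq_zero
    (Eventually.of_forall fun s => by simpa using hmin fun i => y i + s • v i) hd
  have hcoup := sum_inner_coupling (weight_comm ha_symm) y v
  have hsum : ∑ i, ‖v i‖ ^ 2 = 0 := by
    have h1 : ∀ i, ‖v i‖ ^ 2 = inner ℝ (f i (y i)) (v i)
        + K * inner ℝ (∑ j, weight G a i j • (y j - y i)) (v i) := fun i => by
      rw [← real_inner_self_eq_norm_sq, ← real_inner_smul_left, ← inner_add_left, ← rhs_eq]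
    simp only [h1, Finset.sum_add_distrib, ← Finset.mul_sum, hcoup]
    simp only [inner_neg_left, Finset.sum_neg_distrib, mul_left_comm _ (2 : ℝ), ← Finset.mul_sum]
      at hzero
    linarith
  intro i
  have := (Finset.sum_eq_zero_iff_of_nonneg fun i _ => sq_nonneg ‖v i‖).1 hsum i (Finset.mem_univ i)
  simpa using this

theorem isCaratheodorySolution_const {y : Fin N → State m} (hy : ∀ i, rhs f G a K y i = 0) :
    IsCaratheodorySolution f G a K y fun _ => y where
  initial := rfl
  absCont i T _ := (LipschitzWith.const (y i)).lipschitzOnWith.absolutelyContinuousOnInterval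
  ode := Eventually.of_forall fun t _ i => by
    rw [hy i]
    exact hasDerivAt_const t (y i)

/-! ### Synchronization -/

theorem tendsto_norm_sub_of_connected {x : ℝ → Fin N → State m} (hG : G.Connected)
    (h : ∀ i j, G.Adj i j → Tendsto (fun t => ‖x t i - x t j‖) atTop (𝓝 0)) (i j : Fin N) :
    Tendsto (fun t => ‖x t i - x t j‖) atTop (𝓝 0) := by
  obtain ⟨p⟩ := hG.preconnected i j
  induction p with
  | nil => simp
  | cons hadj _ ih =>
    refine squeeze_zero (fun t => norm_nonneg _) (fun t => norm_sub_le_norm_sub_add_norm_sub _ _ _)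
      (by simpa using (h _ _ hadj).add ih)

/-- If the `f i` have the common zero `z`, then `∑ i, ‖x i - z‖ ^ 2` is a Lyapunov function whose
rate of decrease controls the disagreement `∑ i, ∑ j, w i j * ‖x i - x j‖ ^ 2`. -/
theorem tendsto_norm_sub_of_common_zero (hfc : ∀ i, Continuous (f i))
    (hf : ∀ i x y, inner ℝ (f i x - f i y) (x - y) ≤ 0) (hG : G.Connected)
    (ha_pos : ∀ i j, G.Adj i j → 0 < a i j) (ha_symm : ∀ i j, G.Adj i j → a i j = a j i)
    (hK : 0 < K) {z : State m} (hz : ∀ i, f i z = 0) {x₀ : Fin N → State m}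
    {x : ℝ → Fin N → State m} (hx : IsCaratheodorySolution f G a K x₀ x) (i j : Fin N) :
    Tendsto (fun t => ‖x t i - x t j‖) atTop (𝓝 0) := by
  have hxc : ContinuousOn x (Ici 0) := continuousOn_pi.2 fun i t ht => by
    have ht0 : (0 : ℝ) ≤ t := ht
    have h := (hx.absCont i (t + 1) (by positivity)).continuousOn
    rw [uIcc_of_le (by positivity)] at h
    exact (h t ⟨ht0, by linarith⟩).mono_of_mem_nhdsWithin
      (mem_nhdsWithin.2 ⟨Iio (t + 1), isOpen_Iio, lt_add_one t, fun s hs => ⟨hs.2, le_of_lt hs.1⟩⟩)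
  have hd : ∀ i t, 0 < t → HasDerivAt (fun s => x s i) (rhs f G a K (x t) i) t := fun i t ht =>
    hasDerivAt_of_absolutelyContinuous (v := fun t => rhs f G a K (x t) i) (hx.absCont i)
      ((continuous_rhs hfc i).comp_continuousOn hxc)
      (hx.ode.mono fun s hs hs0 => hs hs0 i) ht
  set V : ℝ → ℝ := fun t => ∑ i, ‖x t i - z‖ ^ 2 with hVdef
  set W : ℝ → ℝ := fun t => ∑ i, ∑ j, weight G a i j * ‖x t i - x t j‖ ^ 2 with hWdef
  set D : (Fin N → State m) → ℝ := fun y => ∑ i, ∑ j, weight G a i j *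
    (2 * inner ℝ (y i - y j) (rhs f G a K y i - rhs f G a K y j)) with hD
  have hV : ∀ t, 0 < t → HasDerivAt V (∑ i, 2 * inner ℝ (x t i - z) (rhs f G a K (x t) i)) t :=
    fun t ht => HasDerivAt.fun_sum fun i _ => ((hd i t ht).sub_const z).norm_sq
  have hW : ∀ t, 0 < t → HasDerivAt W (D (x t)) t := fun t ht =>
    HasDerivAt.fun_sum fun i _ => HasDerivAt.fun_sum fun j _ =>
      (((hd i t ht).fun_sub (hd j t ht)).norm_sq).const_mul _
  have hterm : ∀ t i j, 0 ≤ weight G a i j * ‖x t i - x t j‖ ^ 2 := fun t i j =>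
    mul_nonneg (weight_nonneg ha_pos i j) (sq_nonneg _)
  have hW0 : ∀ t, 0 ≤ W t := fun t =>
    Finset.sum_nonneg fun i _ => Finset.sum_nonneg fun j _ => hterm t i j
  have hVW : ∀ t, ∑ i, 2 * inner ℝ (x t i - z) (rhs f G a K (x t) i) ≤ -(K * W t) := fun t => by
    have hz0 : ∀ i, rhs f G a K (fun _ => z) i = 0 := fun i => by simp [rhs_eq, hz]
    have h := sum_inner_rhs_sub_le hf ha_symm (K := K) (x t) fun _ => z
    simp only [hz0, sub_zero, sub_sub_sub_cancel_right] at h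
    rw [← Finset.mul_sum]
    simp only [real_inner_comm (x t _ - z)] at h ⊢
    linarith
  have hVanti : AntitoneOn V (Ici 1) := antitoneOn_Ici_of_hasDerivAt_nonpos one_pos hV
    fun t _ => (hVW t).trans (neg_nonpos.2 (mul_nonneg hK.le (hW0 t)))
  -- The trajectory is bounded because `V` is, hence so is the derivative of `W`.
  have hDc : Continuous D := by
    have := continuous_rhs (G := G) (a := a) (K := K) hfc
    simp only [hD]
    fun_prop
  obtain ⟨C, hC⟩ := (isCompact_univ_pi fun _ : Fin N =>
    isCompact_closedBall z √(V 1)).exists_bound_of_continuousOn hDc.continuousOn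
  have hWlim : Tendsto W atTop (𝓝 0) := by
    refine tendsto_zero_of_lyapunov hK hV hW (fun t => Finset.sum_nonneg fun i _ => sq_nonneg _)
      hW0 (fun t _ => hVW t) (C := C) fun t ht => (le_abs_self _).trans (hC (x t) fun i _ => ?_)
    rw [mem_closedBall_iff_norm]
    refine Real.le_sqrt_of_sq_le (le_trans ?_ (hVanti self_mem_Ici (mem_Ici.2 ht) ht))
    exact Finset.single_le_sum (f := fun i => ‖x t i - z‖ ^ 2) (fun i _ => sq_nonneg _)
      (Finset.mem_univ i)
  refine tendsto_norm_sub_of_connected hG (fun i j hij => ?_) i j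
  have hle : ∀ t, ‖x t i - x t j‖ ^ 2 ≤ W t / a i j := fun t => by
    rw [le_div_iff₀ (ha_pos i j hij), mul_comm, ← weight_of_adj (a := a) hij]
    exact (Finset.single_le_sum (f := fun j => weight G a i j * ‖x t i - x t j‖ ^ 2)
      (fun j _ => hterm t i j) (Finset.mem_univ j)).trans
      (Finset.single_le_sum (f := fun i => ∑ j, weight G a i j * ‖x t i - x t j‖ ^ 2)
        (fun i _ => Finset.sum_nonneg fun j _ => hterm t i j) (Finset.mem_univ i))
  have hsq : Tendsto (fun t => ‖x t i - x t j‖ ^ 2) atTop (𝓝 0) :=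
    squeeze_zero (fun t => sq_nonneg _) hle (by simpa using hWlim.div_const (a i j))
  simpa using hsq.sqrt

end Network

end NetSync

theorem theorem1 (N m : ℕ) (f : Fin N → NetSync.State m → NetSync.State m)
    (hA1 : NetSync.AssumptionA1 f) (hA2 : NetSync.AssumptionA2 f)
    (G : SimpleGraph (Fin N)) (hG : G.Connected)
    (a : Fin N → Fin N → ℝ) (ha_pos : ∀ i j, G.Adj i j → 0 < a i j)
    (ha_symm : ∀ i j, G.Adj i j → a i j = a j i)
    (K : ℝ) (hK : 0 ≤ K) :
    (∀ x₀, ∃ x, NetSync.IsCaratheodorySolution f G a K x₀ x) ∧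
      (NetSync.GlobalSync f G a K → (⋂ i, NetSync.zeroSet (f i)).Nonempty) ∧
      (0 < K → (NetSync.GlobalSync f G a K ↔ (⋂ i, NetSync.zeroSet (f i)).Nonempty)) := by
  obtain ⟨F, hF⟩ := hA1
  have hfc : ∀ i, Continuous (f i) := fun i => by
    rw [funext (hF i).2.2.2]
    exact (NetSync.continuous_gradient (hF i).1).neg
  have hf : ∀ i x y, inner ℝ (f i x - f i y) (x - y) ≤ 0 := fun i x y => by
    have hg := fun z => ((hF i).1.differentiable one_ne_zero z).hasGradientAt
    have h := NetSync.inner_gradient_sub_nonneg (hF i).2.1 (hg x) (hg y)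
    rw [(hF i).2.2.2 x, (hF i).2.2.2 y, neg_sub_neg, ← neg_sub, inner_neg_left]
    linarith
  have hex := NetSync.exists_isCaratheodorySolution hfc hf ha_pos ha_symm hK
  have hnec : NetSync.GlobalSync f G a K → (⋂ i, NetSync.zeroSet (f i)).Nonempty := by
    intro hsync
    choose z hz using fun i => (hF i).2.2.1
    obtain ⟨y, hy⟩ := NetSync.exists_equilibrium (fun i => (hF i).1) (fun i => (hF i).2.1) hz
      (fun i => (hF i).2.2.2) (fun i => (hA2.1 i).2) ha_pos ha_symm hK
    -- A synchronizing constant solution has equal components, so its coupling terms vanish.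
    have heq : ∀ i j, y i = y j := fun i j => by
      have h := tendsto_nhds_unique tendsto_const_nhds
        ((hsync y).2 _ (NetSync.isCaratheodorySolution_const hy) i j)
      exact sub_eq_zero.1 (norm_eq_zero.1 h)
    obtain ⟨i₀⟩ := hG.nonempty
    refine ⟨y i₀, mem_iInter.2 fun i => ?_⟩
    have h := hy i
    simp only [NetSync.rhs_eq, heq _ i₀, sub_self, smul_zero, Finset.sum_const_zero,
      add_zero] at h
    exact h
  refine ⟨hex, hnec, fun hKpos => ⟨hnec, ?_⟩⟩
  rintro ⟨z, hz⟩ x₀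
  exact ⟨hex x₀, fun x hx => NetSync.tendsto_norm_sub_of_common_zero hfc hf hG ha_pos ha_symm
    hKpos (fun i => mem_iInter.1 hz i) hx⟩
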